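/- Let $\Gamma$ be a finitely generated group, viewed as a discrete group, which is not amenable, and let $\Gamma$ act by measure-preserving Borel transformations on a standard probability space $(X,\mu)$, essentially freely: for every $\gamma\in\Gamma\setminus\{1\}$ one has $\gamma x\neq x$ for $\mu$-almost every $x$. Let $\mathrm{Aut}(X,\mu)$ be the group of measure-preserving Borel bijections of $X$, identified when they agree almost everywhere, and let $[\Gamma]=\{T\in\mathrm{Aut}(X,\mu): T(x)\in\Gamma x\text{ for almost every }x\}$ be the full group. Fix a finite generating set $S$ of $\Gamma$, let $d_S(x,y)$ be the least $n$ such that $y=s_n\cdots s_1x$ for some $s_1,\dots,s_n\in S\cup S^{-1}$ (and $\infty$ if $y\notin \Gamma x$), and let $$[\Gamma]_1=\Big\{T\in[\Gamma]:\int_X d_S(x,T(x))\,d\mu(x)<\infty\Big\},$$ equipped with the group topology defined by the metric $\tilde d_S(T,U)=\int_X d_S(T(x),U(x))\,d\mu(x)$ (neither the group nor its topology depends on the choice of $S$). Let $D([\Gamma]_1)$ be the derived (commutator) subgroup of $[\Gamma]_1$ and $\overline{D([\Gamma]_1)}$ its closure in $[\Gamma]_1$, with the induced topology. Call a topological group amenable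 if each of its continuous actions on a nonempty compact Hausdorff space admits an invariant Borel probability measure. Then neither $[\Gamma]_1$ nor $\overline{D([\Gamma]_1)}$ is amenable. -/

import Mathlib

open MeasureTheory Filter Topology Set
open scoped ENNReal

universe u v

/-- A topological group is amenable if each of its continuous actions on a nonempty compact
(Hausdorff) space admits an invariant Borel probability measure. -/
def IsAmenableGroup (G : Type u) [Group G] [TopologicalSpace G] : Prop :=
  ∀ (K : Type u) [TopologicalSpace K] [CompactSpace K] [T2Space K] [Nonempty K]
    [MeasurableSpace K] [BorelSpace K] [MulAction G K] [ContinuousSMul G K],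
    ∃ ν : Measure K, IsProbabilityMeasure ν ∧ SMulInvariantMeasure G K ν

section Aut

variable {X : Type u} [MeasurableSpace X]

/-- The group of all bimeasurable measure-preserving bijections of `X` (before identifying those
that agree almost everywhere). The product is composition. -/
def mpPerm (μ : Measure X) : Subgroup (Equiv.Perm X) where
  carrier := {e | MeasurePreserving e μ μ ∧ MeasurePreserving e.symm μ μ}
  one_mem' := ⟨MeasurePreserving.id μ, MeasurePreserving.id μ⟩
  mul_mem' := fun {_ _} ha hb => ⟨ha.1.comp hb.1, hb.2.comp ha.2⟩
  inv_mem' := fun {_} ha => ⟨ha.2, ha.1⟩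

/-- The transformations that are almost everywhere equal to the identity. -/
def nullPerm (μ : Measure X) : Subgroup (mpPerm μ) where
  carrier := {e | ∀ᵐ x ∂μ, e.1 x = x}
  one_mem' := by simp
  mul_mem' := by
    intro a b ha hb
    have ha' : ∀ᵐ x ∂μ, a.1 x = x := ha
    have hb' : ∀ᵐ x ∂μ, b.1 x = x := hb
    change ∀ᵐ x ∂μ, (a * b).1 x = x
    filter_upwards [ha', hb'] with x h1 h2
    change a.1 (b.1 x) = x
    rw [h2, h1]
  inv_mem' := by
    intro a ha
    have ha' : ∀ᵐ x ∂μ, a.1 x = x := ha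
    change ∀ᵐ x ∂μ, a⁻¹.1 x = x
    filter_upwards [ha'] with x h1
    change a.1.symm x = x
    rw [Equiv.symm_apply_eq, h1]

instance nullPerm_normal (μ : Measure X) : (nullPerm μ).Normal where
  conj_mem := by
    intro n hn g
    have h : ∀ᵐ x ∂μ, n.1 (g.1.symm x) = g.1.symm x :=
      g.2.2.quasiMeasurePreserving.ae hn
    change ∀ᵐ x ∂μ, g.1 (n.1 (g.1.symm x)) = x
    filter_upwards [h] with x hx
    rw [hx, Equiv.apply_symm_apply]

/-- `Aut(X, μ)`: measure-preserving bijections of `X`, up to almost everywhere equality. -/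
def MeasureAut (μ : Measure X) : Type u := mpPerm μ ⧸ nullPerm μ

namespace MeasureAut

variable {μ : Measure X}

noncomputable instance : Group (MeasureAut μ) := inferInstanceAs (Group (mpPerm μ ⧸ nullPerm μ))

/-- The class of a measure-preserving bijection. -/
def mk (e : mpPerm μ) : MeasureAut μ := QuotientGroup.mk' (nullPerm μ) e

/-- A representative of an element of `Aut(X, μ)`. -/
noncomputable def rep (T : MeasureAut μ) : mpPerm μ := Quotient.out T

/-- Elements of `Aut(X, μ)` act as maps on `X` through a representative; this map is determined
up to almost everywhere equality. -/
noncomputable instance : CoeFun (MeasureAut μ) (fun _ => X → X) := ⟨fun T => T.rep.1⟩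

theorem mk_rep (T : MeasureAut μ) : mk T.rep = T := Quotient.out_eq T

theorem mk_mul (e f : mpPerm μ) : mk (e * f) = mk e * mk f := rfl

theorem mk_inv (e : mpPerm μ) : mk e⁻¹ = (mk e)⁻¹ := rfl

theorem mk_eq_mk_iff (e f : mpPerm μ) : mk e = mk f ↔ ∀ᵐ x ∂μ, e.1 x = f.1 x := by
  have h1 : mk e = mk f ↔ e⁻¹ * f ∈ nullPerm μ := QuotientGroup.eq
  have h2 : e⁻¹ * f ∈ nullPerm μ ↔ ∀ᵐ x ∂μ, e.1.symm (f.1 x) = x := Iff.rfl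
  rw [h1, h2]
  refine eventually_congr (Eventually.of_forall fun x => ?_)
  rw [Equiv.symm_apply_eq]
  exact eq_comm

theorem rep_mk (e : mpPerm μ) : ∀ᵐ x ∂μ, mk e x = e.1 x :=
  (mk_eq_mk_iff _ _).1 (mk_rep (mk e))

theorem ext_iff_ae {T U : MeasureAut μ} : T = U ↔ ∀ᵐ x ∂μ, T x = U x := by
  rw [← mk_eq_mk_iff, mk_rep, mk_rep]

theorem measurePreserving (T : MeasureAut μ) : MeasurePreserving T μ μ := T.rep.2.1

theorem measurable (T : MeasureAut μ) : Measurable T := T.measurePreserving.measurable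

theorem one_ae : ∀ᵐ x ∂μ, (1 : MeasureAut μ) x = x := rep_mk (1 : mpPerm μ)

theorem mul_ae (T U : MeasureAut μ) : ∀ᵐ x ∂μ, (T * U) x = T (U x) := by
  have h : T * U = mk (T.rep * U.rep) := by rw [mk_mul, mk_rep, mk_rep]
  rw [h]
  exact rep_mk (T.rep * U.rep)

theorem inv_ae (T : MeasureAut μ) : ∀ᵐ x ∂μ, T⁻¹ x = T.rep.1.symm x := by
  have h : T⁻¹ = mk T.rep⁻¹ := by rw [mk_inv, mk_rep]
  rw [h]
  exact rep_mk T.rep⁻¹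

theorem inv_apply_ae (T : MeasureAut μ) : ∀ᵐ x ∂μ, T⁻¹ (T x) = x := by
  filter_upwards [T.measurePreserving.quasiMeasurePreserving.ae T.inv_ae] with x hx
  rw [hx, Equiv.symm_apply_apply]

theorem lintegral_comp (T : MeasureAut μ) (f : X → ℝ≥0∞) :
    ∫⁻ x, f (T x) ∂μ = ∫⁻ x, f x ∂μ :=
  T.measurePreserving.lintegral_map_equiv f
    ⟨T.rep.1, T.rep.2.1.measurable, T.rep.2.2.measurable⟩ |>.symm

theorem ae_comp (T : MeasureAut μ) {p : X → Prop} (h : ∀ᵐ x ∂μ, p x) : ∀ᵐ x ∂μ, p (T x) :=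
  T.measurePreserving.quasiMeasurePreserving.ae h

end MeasureAut

end Aut

section FullGroup

variable {X : Type u} {Γ : Type v} [Group Γ] [MulAction Γ X]

/-- The Schreier graph distance: the least length of a word `s₁ ⋯ sₙ` in `S ∪ S⁻¹` with
`s₁ ⋯ sₙ • x = y` (and `∞` if there is no such word). -/
noncomputable def schreierDist (S : Finset Γ) (x y : X) : ℝ≥0∞ :=
  ⨅ (w : List {g : Γ // g ∈ S ∨ g⁻¹ ∈ S}) (_ : (w.map Subtype.val).prod • x = y),
    (w.length : ℝ≥0∞)

theorem schreierDist_self (S : Finset Γ) (x : X) : schreierDist S x x = 0 :=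
  le_antisymm (iInf₂_le_of_le [] (by simp) (by simp)) zero_le

theorem schreierDist_le_symm (S : Finset Γ) (x y : X) :
    schreierDist S y x ≤ schreierDist S x y := by
  refine le_iInf₂ fun w hw => ?_
  let i : {g : Γ // g ∈ S ∨ g⁻¹ ∈ S} → {g : Γ // g ∈ S ∨ g⁻¹ ∈ S} :=
    fun g => ⟨g.1⁻¹, by rw [inv_inv]; exact g.2.symm⟩
  refine iInf₂_le_of_le (w.map i).reverse ?_ (by simp)
  have : (((w.map i).reverse).map Subtype.val).prod = ((w.map Subtype.val).prod)⁻¹ := by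
    rw [List.prod_inv_reverse, List.map_reverse, List.map_map, List.map_map]
    rfl
  rw [this, ← hw, inv_smul_smul]

theorem schreierDist_comm (S : Finset Γ) (x y : X) :
    schreierDist S x y = schreierDist S y x :=
  le_antisymm (schreierDist_le_symm S y x) (schreierDist_le_symm S x y)

theorem schreierDist_triangle (S : Finset Γ) (x y z : X) :
    schreierDist S x z ≤ schreierDist S x y + schreierDist S y z := by
  refine ENNReal.le_iInf₂_add_iInf₂ fun w hw w' hw' => ?_
  refine iInf₂_le_of_le (w' ++ w) ?_ ?_
  · rw [List.map_append, List.prod_append, mul_smul, hw, hw']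
  · rw [List.length_append]
    push_cast
    rw [add_comm]

theorem one_le_schreierDist (S : Finset Γ) {x y : X} (h : x ≠ y) : 1 ≤ schreierDist S x y := by
  refine le_iInf₂ fun w hw => ?_
  cases w with
  | nil => simp at hw; exact absurd hw h
  | cons a l => simp

variable [MeasurableSpace X]

theorem measurable_schreierDist [StandardBorelSpace X] [MeasurableConstSMul Γ X] (S : Finset Γ)
    {f g : X → X} (hf : Measurable f) (hg : Measurable g) :
    Measurable fun x => schreierDist S (f x) (g x) := by
  classical
  have : Finite {g : Γ // g ∈ S ∨ g⁻¹ ∈ S} := by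
    have h : {g : Γ | g ∈ S ∨ g⁻¹ ∈ S} = (S : Set Γ) ∪ (S : Set Γ)⁻¹ := by
      ext; simp
    have h' : {g : Γ | g ∈ S ∨ g⁻¹ ∈ S}.Finite := by
      rw [h]; exact S.finite_toSet.union S.finite_toSet.inv
    exact h'.to_subtype
  have : Countable {g : Γ // g ∈ S ∨ g⁻¹ ∈ S} := Finite.to_countable
  refine Measurable.iInf fun w => ?_
  simp_rw [iInf_eq_if]
  exact Measurable.ite (measurableSet_eq_fun (hf.const_smul _) hg) measurable_const
    measurable_const

/-- The full group `[Γ]`: all `T ∈ Aut(X, μ)` with `T x ∈ Γ • x` for almost every `x`. -/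
def fullGroup (Γ : Type v) [Group Γ] [MulAction Γ X] (μ : Measure X) :
    Subgroup (MeasureAut μ) where
  carrier := {T | ∀ᵐ x ∂μ, T x ∈ MulAction.orbit Γ x}
  one_mem' := by
    change ∀ᵐ x ∂μ, (1 : MeasureAut μ) x ∈ MulAction.orbit Γ x
    filter_upwards [MeasureAut.one_ae (μ := μ)] with x hx
    rw [hx]
    exact MulAction.mem_orbit_self x
  mul_mem' := by
    intro T U hT hU
    have hT' : ∀ᵐ x ∂μ, T x ∈ MulAction.orbit Γ x := hT
    have hU' : ∀ᵐ x ∂μ, U x ∈ MulAction.orbit Γ x := hU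
    change ∀ᵐ x ∂μ, (T * U) x ∈ MulAction.orbit Γ x
    filter_upwards [MeasureAut.mul_ae T U, U.ae_comp hT', hU'] with x h1 h2 h3
    rw [h1]
    rw [← MulAction.orbit_eq_iff] at *
    rw [h2, h3]
  inv_mem' := by
    intro T hT
    have hT' : ∀ᵐ x ∂μ, T x ∈ MulAction.orbit Γ x := hT
    change ∀ᵐ x ∂μ, T⁻¹ x ∈ MulAction.orbit Γ x
    filter_upwards [(T⁻¹).ae_comp hT', (T⁻¹).inv_apply_ae] with x h1 h2
    rw [inv_inv] at h2
    rw [h2] at h1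
    exact MulAction.mem_orbit_symm.1 h1

variable [StandardBorelSpace X] [MeasurableConstSMul Γ X]

theorem lintegral_schreierDist_triangle (μ : Measure X) (S : Finset Γ) {f g h : X → X}
    (hf : Measurable f) (hg : Measurable g) :
    ∫⁻ x, schreierDist S (f x) (h x) ∂μ ≤
      ∫⁻ x, schreierDist S (f x) (g x) ∂μ + ∫⁻ x, schreierDist S (g x) (h x) ∂μ := by
  rw [← lintegral_add_left (measurable_schreierDist S hf hg)]
  exact lintegral_mono fun x => schreierDist_triangle S _ _ _

/-- The `L¹` full group `[Γ]₁`: all `T ∈ [Γ]` such that `x ↦ d_S(x, T x)` is integrable.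
It is meant for finite generating sets `S` of `Γ`. -/
noncomputable def l1FullGroup (μ : Measure X) (S : Finset Γ) : Subgroup (MeasureAut μ) where
  carrier := {T | T ∈ fullGroup Γ μ ∧ ∫⁻ x, schreierDist S x (T x) ∂μ < ∞}
  one_mem' := by
    refine ⟨one_mem _, ?_⟩
    have h : ∫⁻ x, schreierDist S x ((1 : MeasureAut μ) x) ∂μ = ∫⁻ _, 0 ∂μ := by
      refine lintegral_congr_ae ?_
      filter_upwards [MeasureAut.one_ae (μ := μ)] with x hx
      rw [hx, schreierDist_self]
    rw [h]
    simp
  mul_mem' := by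
    intro T U hT hU
    refine ⟨mul_mem hT.1 hU.1, ?_⟩
    have h : ∫⁻ x, schreierDist S x ((T * U) x) ∂μ = ∫⁻ x, schreierDist S x (T (U x)) ∂μ := by
      refine lintegral_congr_ae ?_
      filter_upwards [MeasureAut.mul_ae T U] with x hx
      rw [hx]
    rw [h]
    refine (lintegral_schreierDist_triangle μ S measurable_id U.measurable).trans_lt ?_
    refine ENNReal.add_lt_top.2 ⟨hU.2, ?_⟩
    rw [U.lintegral_comp fun y => schreierDist S y (T y)]
    exact hT.2
  inv_mem' := by
    intro T hT
    refine ⟨inv_mem hT.1, ?_⟩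
    rw [← T.lintegral_comp fun y => schreierDist S y (T⁻¹ y)]
    refine lt_of_eq_of_lt ?_ hT.2
    refine lintegral_congr_ae ?_
    filter_upwards [T.inv_apply_ae] with x hx
    rw [hx, schreierDist_comm]

variable {μ : Measure X} {S : Finset Γ}

/-- The metric `d(T, U) = ∫ d_S(T x, U x) dμ(x)` on the `L¹` full group; it defines the topology
of `[Γ]₁`. -/
noncomputable instance l1FullGroup.instEMetricSpace : EMetricSpace (l1FullGroup μ S) where
  edist T U := ∫⁻ x, schreierDist S (T.1 x) (U.1 x) ∂μ
  edist_self T := by simp [schreierDist_self]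
  edist_comm T U := by simp_rw [schreierDist_comm S (T.1 _)]
  edist_triangle T U V := lintegral_schreierDist_triangle μ S T.1.measurable U.1.measurable
  eq_of_edist_eq_zero := by
    intro T U h
    have h' := (lintegral_eq_zero_iff
      (measurable_schreierDist S T.1.measurable U.1.measurable)).1 h
    refine Subtype.ext (MeasureAut.ext_iff_ae.2 ?_)
    filter_upwards [h'] with x hx
    by_contra hne
    have := one_le_schreierDist S hne
    rw [hx] at this
    simp at this

namespace l1FullGroup

theorem edist_def (T U : l1FullGroup μ S) :
    edist T U = ∫⁻ x, schreierDist S (T.1 x) (U.1 x) ∂μ := rfl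

theorem edist_mul_right (T U V : l1FullGroup μ S) : edist (T * V) (U * V) = edist T U := by
  rw [edist_def, edist_def,
    ← V.1.lintegral_comp fun y => schreierDist S (T.1 y) (U.1 y)]
  refine lintegral_congr_ae ?_
  filter_upwards [MeasureAut.mul_ae T.1 V.1, MeasureAut.mul_ae U.1 V.1] with x h1 h2
  change schreierDist S ((T.1 * V.1) x) ((U.1 * V.1) x) = _
  rw [h1, h2]

theorem edist_ne_top (T U : l1FullGroup μ S) : edist T U ≠ ∞ := by
  refine ((lintegral_schreierDist_triangle μ S T.1.measurable measurable_id).trans_lt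
    (ENNReal.add_lt_top.2 ⟨?_, U.2.2⟩)).ne
  simp_rw [schreierDist_comm S (T.1 _)]
  exact T.2.2

theorem measure_ne_le_edist (T U : l1FullGroup μ S) : μ {x | T.1 x ≠ U.1 x} ≤ edist T U := by
  have hm : MeasurableSet {x | T.1 x ≠ U.1 x} :=
    (measurableSet_eq_fun T.1.measurable U.1.measurable).compl
  rw [edist_def, ← lintegral_indicator_one hm]
  refine lintegral_mono fun x => ?_
  by_cases h : T.1 x = U.1 x
  · simp [h]
  · simpa [h] using one_le_schreierDist S h

theorem edist_mul_left_le (V T U : l1FullGroup μ S) :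
    edist (V * T) (V * U) ≤
      ∫⁻ y in T.1.rep.1.symm ⁻¹' {x | T.1 x ≠ U.1 x}, schreierDist S y (V.1 y) ∂μ
        + edist T U
        + ∫⁻ y in U.1.rep.1.symm ⁻¹' {x | T.1 x ≠ U.1 x}, schreierDist S y (V.1 y) ∂μ := by
  set A : Set X := {x | T.1 x ≠ U.1 x} with hA
  have hm : MeasurableSet A := (measurableSet_eq_fun T.1.measurable U.1.measurable).compl
  have key : ∀ W : MeasureAut μ,
      ∫⁻ y in W.rep.1.symm ⁻¹' A, schreierDist S y (V.1 y) ∂μ =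
        ∫⁻ x, A.indicator (fun x => schreierDist S (W x) (V.1 (W x))) x ∂μ := by
    intro W
    rw [← lintegral_indicator (W.rep.2.2.measurable hm), ← W.lintegral_comp]
    refine lintegral_congr fun x => ?_
    by_cases hx : x ∈ A <;> simp [hx]
  have hmeas : ∀ W : MeasureAut μ,
      Measurable (A.indicator (fun x => schreierDist S (W x) (V.1 (W x)))) := fun W =>
    (measurable_schreierDist S W.measurable (V.1.measurable.comp W.measurable)).indicator hm
  rw [key, key, edist_def T U,
    ← lintegral_add_left (hmeas T.1), ← lintegral_add_right _ (hmeas U.1), edist_def]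
  refine lintegral_mono_ae ?_
  filter_upwards [MeasureAut.mul_ae V.1 T.1, MeasureAut.mul_ae V.1 U.1] with x h1 h2
  change schreierDist S ((V.1 * T.1) x) ((V.1 * U.1) x) ≤ _
  rw [h1, h2]
  by_cases hx : x ∈ A
  · simp only [hx, indicator_of_mem]
    refine (schreierDist_triangle S _ (U.1 x) _).trans (add_le_add ?_ le_rfl)
    refine (schreierDist_triangle S _ (T.1 x) _).trans (add_le_add ?_ le_rfl)
    rw [schreierDist_comm]
  · have : T.1 x = U.1 x := not_not.1 hx
    rw [this, schreierDist_self]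
    exact zero_le

theorem continuous_mul_left (V : l1FullGroup μ S) :
    Continuous fun T : l1FullGroup μ S => V * T := by
  refine continuous_iff_continuousAt.2 fun U => tendsto_iff_edist_tendsto_0.2 ?_
  have h0 : Tendsto (fun T : l1FullGroup μ S => edist T U) (𝓝 U) (𝓝 0) :=
    tendsto_iff_edist_tendsto_0.1 tendsto_id
  have hA : Tendsto (fun T : l1FullGroup μ S => μ {x | T.1 x ≠ U.1 x}) (𝓝 U) (𝓝 0) :=
    tendsto_of_tendsto_of_tendsto_of_le_of_le tendsto_const_nhds h0 (fun _ => zero_le)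
      fun T => measure_ne_le_edist T U
  have hmeas : ∀ T : l1FullGroup μ S, ∀ W : MeasureAut μ,
      μ (W.rep.1.symm ⁻¹' {x | T.1 x ≠ U.1 x}) = μ {x | T.1 x ≠ U.1 x} := fun T W =>
    W.rep.2.2.measure_preimage
      (measurableSet_eq_fun T.1.measurable U.1.measurable).compl.nullMeasurableSet
  have h1 := tendsto_setLIntegral_zero (μ := μ) V.2.2.ne
    (s := fun T : l1FullGroup μ S => T.1.rep.1.symm ⁻¹' {x | T.1 x ≠ U.1 x}) (l := 𝓝 U)
    (by simpa only [Function.comp_def, hmeas] using hA)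
  have h2 := tendsto_setLIntegral_zero (μ := μ) V.2.2.ne
    (s := fun T : l1FullGroup μ S => U.1.rep.1.symm ⁻¹' {x | T.1 x ≠ U.1 x}) (l := 𝓝 U)
    (by simpa only [Function.comp_def, hmeas] using hA)
  have h3 := (h1.add h0).add h2
  simp only [add_zero] at h3
  exact tendsto_of_tendsto_of_tendsto_of_le_of_le tendsto_const_nhds h3 (fun _ => zero_le)
    fun T => edist_mul_left_le V T U

instance instIsTopologicalGroup : IsTopologicalGroup (l1FullGroup μ S) where
  continuous_mul := by
    refine continuous_iff_continuousAt.2 fun ⟨T, U⟩ => tendsto_iff_edist_tendsto_0.2 ?_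
    have h1 : Tendsto (fun p : l1FullGroup μ S × l1FullGroup μ S => edist p.1 T)
        (𝓝 (T, U)) (𝓝 0) := tendsto_iff_edist_tendsto_0.1 continuous_fst.continuousAt
    have h2 : Tendsto (fun p : l1FullGroup μ S × l1FullGroup μ S => edist (T * p.2) (T * U))
        (𝓝 (T, U)) (𝓝 0) := tendsto_iff_edist_tendsto_0.1
      ((continuous_mul_left T).comp continuous_snd).continuousAt
    have h3 := h1.add h2
    simp only [add_zero] at h3
    refine tendsto_of_tendsto_of_tendsto_of_le_of_le tendsto_const_nhds h3 (fun _ => zero_le)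
      fun p => ?_
    refine (edist_triangle _ (T * p.2) _).trans ?_
    change edist (p.1 * p.2) (T * p.2) + _ ≤ _
    rw [edist_mul_right]
  continuous_inv := by
    refine continuous_iff_continuousAt.2 fun T => tendsto_iff_edist_tendsto_0.2 ?_
    have h : Tendsto (fun U : l1FullGroup μ S => edist (T⁻¹ * U) (T⁻¹ * T)) (𝓝 T) (𝓝 0) :=
      tendsto_iff_edist_tendsto_0.1 (continuous_mul_left T⁻¹).continuousAt
    refine h.congr fun U => ?_
    rw [← edist_mul_right U⁻¹ T⁻¹ U, inv_mul_cancel, inv_mul_cancel, edist_comm]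

end l1FullGroup

end FullGroup

/-! ### Finitely additive means and invariant measures on compact spaces -/

section Amenable

open TopologicalSpace NNReal

/-! Amenability of either group would give Γ an invariant mean. The compact space to use is
`OrbitCharge Γ μ`: finitely additive probability measures m on X × X that live on the orbit relation
and have first marginal μ. A transformation T pushes m forward by acting on the first coordinate.
The marginal makes this action continuous: altering T on a set of measure ε moves m(E) by at most ε
(`IsOrbitCharge.abs_sub_le`), and the L¹ distance dominates that measure.

An invariant probability measure on this space has a barycenter m, again a charge
(`IsOrbitCharge.integral`), invariant under every commutator. Invariance under γ ∈ Γ itself follows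
although γ need not be a commutator. If A, γA and δA are disjoint, the commutator of the involutions
swapping A with γA and A with δA equals γ on A (`exists_commutator_eq_smul`). Countably many such A
cover X up to a null set (`exists_cover_disjoint_translates`), and the marginal supplies the
countable additivity needed to glue (`IsOrbitCharge.preimage_smul_eq`).

Finally B ↦ m{(x, y) : x ∈ By} is an invariant mean on Γ, additive by essential freeness
(`IsOrbitCharge.isAmenableGroup`), and an invariant mean makes Γ amenable
(`IsAmenableGroup.of_invariant_additive`). A third element δ is missing only in very small groups;
finite groups are amenable anyway. -/

/-- The value on a set `C` of the upper regularization, along open neighbourhoods, of a set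
function `a`. -/
noncomputable def openEnvelope {K : Type*} [TopologicalSpace K] (a : Set K → ℝ≥0) (C : Set K) :
    ℝ≥0 :=
  ⨅ U : {U : Set K // IsOpen U ∧ C ⊆ U}, a U.1

theorem openEnvelope_le {K : Type*} [TopologicalSpace K] (a : Set K → ℝ≥0) {C U : Set K}
    (hU : IsOpen U) (h : C ⊆ U) : openEnvelope a C ≤ a U :=
  ciInf_le (OrderBot.bddBelow _) (⟨U, hU, h⟩ : {U : Set K // IsOpen U ∧ C ⊆ U})

theorem le_openEnvelope {K : Type*} [TopologicalSpace K] (a : Set K → ℝ≥0) {C : Set K} {r : ℝ≥0}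
    (h : ∀ U, IsOpen U → C ⊆ U → r ≤ a U) : r ≤ openEnvelope a C := by
  have : Nonempty {U : Set K // IsOpen U ∧ C ⊆ U} := ⟨⟨univ, isOpen_univ, subset_univ _⟩⟩
  exact le_ciInf fun U => h U.1 U.2.1 U.2.2

theorem mono_of_additive {K : Type*} {a : Set K → ℝ≥0}
    (hadd : ∀ s t, Disjoint s t → a (s ∪ t) = a s + a t) {s t : Set K} (h : s ⊆ t) :
    a s ≤ a t := by
  rw [← union_sdiff_cancel h, hadd _ _ disjoint_sdiff_right]
  exact le_self_add

theorem openEnvelope_union_le {K : Type*} [TopologicalSpace K] {a : Set K → ℝ≥0}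
    (hadd : ∀ s t, Disjoint s t → a (s ∪ t) = a s + a t) (C D : Set K) :
    openEnvelope a (C ∪ D) ≤ openEnvelope a C + openEnvelope a D := by
  have : ∀ C : Set K, Nonempty {U : Set K // IsOpen U ∧ C ⊆ U} :=
    fun C => ⟨⟨univ, isOpen_univ, subset_univ _⟩⟩
  refine NNReal.le_iInf_add_iInf fun U V => ?_
  refine (openEnvelope_le a (U.2.1.union V.2.1) (union_subset_union U.2.2 V.2.2)).trans ?_
  rw [← union_sdiff_self, hadd _ _ disjoint_sdiff_right]
  gcongr
  exact mono_of_additive hadd sdiff_subset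

/-- A finitely additive measure on all subsets of a Hausdorff space yields a content. -/
noncomputable def contentOfAdditive {K : Type*} [TopologicalSpace K] [T2Space K]
    (a : Set K → ℝ≥0) (hadd : ∀ s t, Disjoint s t → a (s ∪ t) = a s + a t) : Content K where
  toFun C := openEnvelope a C
  mono' C D h := le_openEnvelope a fun U hU hD => openEnvelope_le a hU (h.trans hD)
  sup_le' C D := by
    rw [Compacts.coe_sup]
    exact openEnvelope_union_le hadd _ _
  sup_disjoint' C D h _ _ := by
    rw [Compacts.coe_sup]
    apply le_antisymm (openEnvelope_union_le hadd _ _)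
    -- Disjoint compact sets have disjoint open neighbourhoods, and these cut any open `W` around
    -- both sets into two disjoint competitors.
    obtain ⟨U, V, hU, hV, hCU, hDV, hUV⟩ :=
      SeparatedNhds.of_isCompact_isCompact C.isCompact D.isCompact h
    refine le_openEnvelope a fun W hW hCD => ?_
    calc openEnvelope a C + openEnvelope a D ≤ a (W ∩ U) + a (W ∩ V) :=
          add_le_add
            (openEnvelope_le a (hW.inter hU) (subset_inter (subset_union_left.trans hCD) hCU))
            (openEnvelope_le a (hW.inter hV) (subset_inter (subset_union_right.trans hCD) hDV))
      _ = a (W ∩ U ∪ W ∩ V) :=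
          (hadd _ _ (hUV.mono inter_subset_right inter_subset_right)).symm
      _ ≤ a W := mono_of_additive hadd (union_subset inter_subset_left inter_subset_left)

/-- A group with an invariant finitely additive probability measure on all its subsets is amenable
(as a group acting by homeomorphisms). -/
theorem IsAmenableGroup.of_invariant_additive {Γ : Type v} [Group Γ] [TopologicalSpace Γ]
    (n : Set Γ → ℝ≥0) (h1 : n univ = 1) (hadd : ∀ s t, Disjoint s t → n (s ∪ t) = n s + n t)
    (hinv : ∀ (g : Γ) (s : Set Γ), n ((g * ·) ⁻¹' s) = n s) : IsAmenableGroup Γ := by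
  intro K _ _ _ _ _ _ _ _
  -- The mean is pushed forward along the orbit map of an arbitrary point; regularizing the result
  -- to a content makes it countably additive.
  let k : K := Classical.arbitrary K
  let a : Set K → ℝ≥0 := fun s => n ((fun g : Γ => g • k) ⁻¹' s)
  have ha : ∀ s t, Disjoint s t → a (s ∪ t) = a s + a t := fun s t h => by
    simp only [a, preimage_union]
    exact hadd _ _ (h.preimage _)
  have hainv : ∀ (g : Γ) (s : Set K), a ((g • ·) ⁻¹' s) = a s := fun g s => by
    simp only [a]
    rw [← hinv g ((fun g : Γ => g • k) ⁻¹' s)]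
    simp [preimage_preimage, mul_smul]
  let c := contentOfAdditive a ha
  refine ⟨c.measure, ⟨?_⟩, ⟨fun g s hs => ?_⟩⟩
  · rw [c.measure_apply MeasurableSet.univ, c.outerMeasure_of_isOpen _ isOpen_univ,
      c.innerContent_of_isCompact isCompact_univ isOpen_univ]
    change ((openEnvelope a univ : ℝ≥0) : ℝ≥0∞) = 1
    have : openEnvelope a univ = a univ :=
      le_antisymm (openEnvelope_le a isOpen_univ Subset.rfl)
        (le_openEnvelope a fun U _ hU => by rw [univ_subset_iff.1 hU])
    rw [this]
    simp [a, h1]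
  · rw [c.measure_apply hs, c.measure_apply (hs.preimage (measurable_const_smul g))]
    refine c.outerMeasure_preimage (Homeomorph.smul g) (fun C => ?_) s
    change ((openEnvelope a ((g • ·) '' (C : Set K)) : ℝ≥0) : ℝ≥0∞) =
      ((openEnvelope a C : ℝ≥0) : ℝ≥0∞)
    congr 1
    apply le_antisymm
    · refine le_openEnvelope a fun U hU hC => ?_
      rw [← hainv g⁻¹ U]
      refine openEnvelope_le a (hU.preimage (continuous_const_smul _)) ?_
      rintro _ ⟨x, hx, rfl⟩
      simpa using hC hx
    · refine le_openEnvelope a fun U hU hC => ?_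
      rw [← hainv g U]
      exact openEnvelope_le a (hU.preimage (continuous_const_smul _)) (image_subset_iff.1 hC)

theorem IsAmenableGroup.of_finite (Γ : Type v) [Group Γ] [TopologicalSpace Γ] [Finite Γ] :
    IsAmenableGroup Γ := by
  have hpos : (Nat.card Γ : ℝ≥0) ≠ 0 := Nat.cast_ne_zero.2 Nat.card_pos.ne'
  refine .of_invariant_additive (fun s => (s.ncard : ℝ≥0) / Nat.card Γ) ?_ (fun s t h => ?_)
    fun g s => ?_
  · simp [ncard_univ, hpos]
  · simp [ncard_union_eq h, add_div]
  · have : (g * ·) ⁻¹' s = (g⁻¹ * ·) '' s := by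
      ext x
      simp
    simp only [this, ncard_image_of_injective _ (mul_right_injective g⁻¹)]

end Amenable

/-! ### Word length in a finite generating set -/

section Words

variable {Γ : Type v} [Group Γ]

theorem exists_word {S : Finset Γ} (hS : Subgroup.closure (S : Set Γ) = ⊤) (γ : Γ) :
    ∃ w : List {g : Γ // g ∈ S ∨ g⁻¹ ∈ S}, (w.map Subtype.val).prod = γ := by
  have h : γ ∈ Submonoid.closure ((S : Set Γ) ∪ (S : Set Γ)⁻¹) := by
    rw [← Subgroup.closure_toSubmonoid, hS]
    trivial
  obtain ⟨l, hl, rfl⟩ := Submonoid.exists_list_of_mem_closure h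
  lift l to List {g : Γ // g ∈ S ∨ g⁻¹ ∈ S} using fun g hg => by simpa using hl g hg
  exact ⟨l, rfl⟩

theorem countable_of_closure_eq_top {S : Finset Γ} (hS : Subgroup.closure (S : Set Γ) = ⊤) :
    Countable Γ := by
  have : Countable {g : Γ // g ∈ S ∨ g⁻¹ ∈ S} := by
    have : {g : Γ | g ∈ S ∨ g⁻¹ ∈ S} = (S : Set Γ) ∪ (S : Set Γ)⁻¹ := by
      ext
      simp
    have h' : {g : Γ | g ∈ S ∨ g⁻¹ ∈ S}.Countable := by
      rw [this]
      exact (S.finite_toSet.union S.finite_toSet.inv).countable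
    exact h'.to_subtype
  exact Function.Surjective.countable (exists_word hS)

theorem exists_schreierDist_smul_le {X : Type u} [MulAction Γ X] {S : Finset Γ}
    (hS : Subgroup.closure (S : Set Γ) = ⊤) (γ : Γ) :
    ∃ L : ℕ, ∀ x : X, schreierDist S x (γ • x) ≤ L := by
  obtain ⟨w, hw⟩ := exists_word hS γ
  exact ⟨w.length, fun x => iInf₂_le_of_le w (by rw [hw]) le_rfl⟩

end Words

/-! ### Swap involutions and their commutators -/

section Swap

variable {Γ : Type v} [Group Γ] {X : Type u} [MulAction Γ X]

open Classical in
/-- The map exchanging `A` and `γ • A` by means of `γ`. -/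
noncomputable def swapFun (γ : Γ) (A : Set X) (x : X) : X :=
  if x ∈ A then γ • x else if γ⁻¹ • x ∈ A then γ⁻¹ • x else x

theorem swapFun_of_mem {γ : Γ} {A : Set X} {x : X} (hx : x ∈ A) : swapFun γ A x = γ • x :=
  if_pos hx

theorem swapFun_smul {γ : Γ} {A : Set X} {x : X} (hx : x ∈ A) (h : γ • x ∉ A) :
    swapFun γ A (γ • x) = x := by
  simp [swapFun, h, hx]

theorem swapFun_of_notMem {γ : Γ} {A : Set X} {x : X} (hx : x ∉ A) (h : γ⁻¹ • x ∉ A) :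
    swapFun γ A x = x := by
  simp [swapFun, h, hx]

theorem swapFun_involutive {γ : Γ} {A : Set X} (h : ∀ x ∈ A, γ • x ∉ A) :
    Function.Involutive (swapFun γ A) := by
  intro x
  by_cases hx : x ∈ A
  · rw [swapFun_of_mem hx, swapFun_smul hx (h x hx)]
  · by_cases hx' : γ⁻¹ • x ∈ A
    · have : swapFun γ A x = γ⁻¹ • x := by simp [swapFun, hx, hx']
      rw [this, swapFun_of_mem hx', smul_inv_smul]
    · rw [swapFun_of_notMem hx hx', swapFun_of_notMem hx hx']

theorem swapFun_mem_orbit (γ : Γ) (A : Set X) (x : X) : swapFun γ A x ∈ MulAction.orbit Γ x := by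
  unfold swapFun
  split_ifs
  · exact MulAction.mem_orbit _ _
  · exact MulAction.mem_orbit _ _
  · exact MulAction.mem_orbit_self _

theorem exists_schreierDist_swapFun_le {S : Finset Γ}
    (hS : Subgroup.closure (S : Set Γ) = ⊤) (γ : Γ) (A : Set X) :
    ∃ L : ℕ, ∀ x : X, schreierDist S x (swapFun γ A x) ≤ L := by
  obtain ⟨L, hL⟩ := exists_schreierDist_smul_le (X := X) hS γ
  refine ⟨L, fun x => ?_⟩
  unfold swapFun
  split_ifs
  · exact hL x
  · rw [schreierDist_comm]
    simpa using hL (γ⁻¹ • x)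
  · rw [schreierDist_self]
    exact zero_le

variable [MeasurableSpace X] [MeasurableConstSMul Γ X]

theorem measurable_swapFun (γ : Γ) {A : Set X} (hA : MeasurableSet A) :
    Measurable (swapFun γ A) :=
  Measurable.ite hA (measurable_const_smul γ) (Measurable.ite
    (hA.preimage (measurable_const_smul γ⁻¹)) (measurable_const_smul γ⁻¹) measurable_id)

theorem measurePreserving_swapFun (μ : Measure X) [SMulInvariantMeasure Γ X μ] {γ : Γ} {A : Set X}
    (hA : MeasurableSet A) (h : ∀ x ∈ A, γ • x ∉ A) : MeasurePreserving (swapFun γ A) μ μ := by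
  refine ⟨measurable_swapFun γ hA, Measure.ext fun E hE => ?_⟩
  set B : Set X := (γ⁻¹ • ·) ⁻¹' A
  have hB : MeasurableSet B := hA.preimage (measurable_const_smul γ⁻¹)
  -- Here `B` is γA. The swap exchanges the parts over `A` and `B`, where invariance of μ under γ
  -- applies, and fixes the rest.
  have split : ∀ F : Set X, μ F = μ (F ∩ A) + (μ (F \ A ∩ B) + μ ((F \ A) \ B)) := fun F => by
    rw [measure_inter_add_sdiff _ hB, measure_inter_add_sdiff _ hA]
  have hBA : ∀ x ∈ B, x ∉ A := fun x hx hx' => by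
    have := h _ hx
    simp only [smul_inv_smul] at this
    exact this hx'
  rw [Measure.map_apply (measurable_swapFun γ hA) hE, split, split E, ← add_assoc, ← add_assoc]
  have e1 : μ (swapFun γ A ⁻¹' E ∩ A) = μ (E \ A ∩ B) := by
    rw [← measure_preimage_smul_of_nullMeasurableSet (c := γ) (μ := μ)
      ((hE.diff hA).inter hB).nullMeasurableSet]
    congr 1
    ext x
    simp only [mem_inter_iff, mem_preimage, Set.mem_sdiff, B, inv_smul_smul]
    constructor
    · rintro ⟨h1, h2⟩
      rw [swapFun_of_mem h2] at h1
      exact ⟨⟨h1, h x h2⟩, h2⟩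
    · rintro ⟨⟨h1, _⟩, h2⟩
      exact ⟨by rwa [swapFun_of_mem h2], h2⟩
  have e2 : μ (swapFun γ A ⁻¹' E \ A ∩ B) = μ (E ∩ A) := by
    rw [← measure_preimage_smul_of_nullMeasurableSet (c := γ⁻¹) (μ := μ)
      (hE.inter hA).nullMeasurableSet]
    congr 1
    ext x
    simp only [mem_inter_iff, mem_preimage, Set.mem_sdiff, B]
    constructor
    · rintro ⟨⟨h1, h2⟩, h3⟩
      have : swapFun γ A x = γ⁻¹ • x := by simp [swapFun, h2, h3]
      exact ⟨this ▸ h1, h3⟩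
    · rintro ⟨h1, h2⟩
      have h3 := hBA x h2
      have : swapFun γ A x = γ⁻¹ • x := by simp [swapFun, h2, h3]
      exact ⟨⟨by rwa [this], h3⟩, h2⟩
  have e3 : (swapFun γ A ⁻¹' E \ A) \ B = (E \ A) \ B := by
    ext x
    simp only [Set.mem_sdiff, B]
    refine ⟨fun ⟨⟨h1, h2⟩, h3⟩ => ?_, fun ⟨⟨h1, h2⟩, h3⟩ => ?_⟩
    · rw [mem_preimage, swapFun_of_notMem h2 h3] at h1
      exact ⟨⟨h1, h2⟩, h3⟩
    · refine ⟨⟨?_, h2⟩, h3⟩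
      rwa [mem_preimage, swapFun_of_notMem h2 h3]
  rw [e1, e2, e3, add_comm (μ (E \ A ∩ B))]

/-- `swapFun` as a measure-preserving bijection. -/
noncomputable def swapPerm (μ : Measure X) [SMulInvariantMeasure Γ X μ] (γ : Γ) {A : Set X}
    (hA : MeasurableSet A) (h : ∀ x ∈ A, γ • x ∉ A) : mpPerm μ :=
  ⟨(swapFun_involutive h).toPerm _,
    measurePreserving_swapFun μ hA h, measurePreserving_swapFun μ hA h⟩

variable [StandardBorelSpace X]

/-- The displacement is bounded by the length of a word for γ, hence integrable as μ is finite. -/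
theorem mk_swapPerm_mem (μ : Measure X) [IsFiniteMeasure μ] [SMulInvariantMeasure Γ X μ]
    {S : Finset Γ} (hS : Subgroup.closure (S : Set Γ) = ⊤) (γ : Γ) {A : Set X}
    (hA : MeasurableSet A) (h : ∀ x ∈ A, γ • x ∉ A) :
    MeasureAut.mk (swapPerm μ γ hA h) ∈ l1FullGroup μ S := by
  have hrep := MeasureAut.rep_mk (swapPerm μ γ hA h)
  refine ⟨?_, ?_⟩
  · change ∀ᵐ x ∂μ, _ ∈ _
    filter_upwards [hrep] with x hx
    rw [hx]
    exact swapFun_mem_orbit γ A x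
  · obtain ⟨L, hL⟩ := exists_schreierDist_swapFun_le (X := X) hS γ A
    refine (lintegral_mono_ae (g := fun _ => (L : ℝ≥0∞)) ?_).trans_lt ?_
    · filter_upwards [hrep] with x hx
      rw [hx]
      exact hL x
    · rw [lintegral_const]
      exact ENNReal.mul_lt_top (ENNReal.natCast_lt_top L) (measure_lt_top μ _)

/-- If `A`, `γ • A` and `δ • A` are disjoint, some commutator in the `L¹` full group agrees with
`γ` on `A`. -/
theorem exists_commutator_eq_smul (μ : Measure X) [IsFiniteMeasure μ] [SMulInvariantMeasure Γ X μ]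
    {S : Finset Γ} (hS : Subgroup.closure (S : Set Γ) = ⊤) (γ δ : Γ) {A : Set X}
    (hA : MeasurableSet A) (hγ : ∀ x ∈ A, γ • x ∉ A) (hδ : ∀ x ∈ A, δ • x ∉ A)
    (hγδ : ∀ x ∈ A, γ⁻¹ • δ • x ∉ A) :
    ∃ T ∈ commutator (l1FullGroup μ S), ∀ᵐ x ∂μ, x ∈ A → T.1 x = γ • x := by
  let s := swapPerm μ γ hA hγ
  let t := swapPerm μ δ hA hδ
  let s' : l1FullGroup μ S := ⟨_, mk_swapPerm_mem μ hS γ hA hγ⟩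
  let t' : l1FullGroup μ S := ⟨_, mk_swapPerm_mem μ hS δ hA hδ⟩
  refine ⟨s' * t' * s'⁻¹ * t'⁻¹,
    Subgroup.commutator_mem_commutator (Subgroup.mem_top _) (Subgroup.mem_top _), ?_⟩
  change ∀ᵐ x ∂μ, x ∈ A → MeasureAut.mk (s * t * s⁻¹ * t⁻¹) x = γ • x
  filter_upwards [MeasureAut.rep_mk (s * t * s⁻¹ * t⁻¹)] with x hx hxA
  rw [hx]
  change swapFun γ A (swapFun δ A (swapFun γ A (swapFun δ A x))) = γ • x
  -- The point travels x ↦ δx ↦ δx ↦ x ↦ γx: the first γ-swap fixes δx, which lies outside A ∪ γA.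
  rw [swapFun_of_mem (γ := δ) hxA, swapFun_of_notMem (hδ x hxA) (hγδ x hxA),
    swapFun_smul hxA (hδ x hxA), swapFun_of_mem hxA]

/-- If three points `x`, `γ • x` and `δ • x` are almost surely distinct, countably many sets `A` as
in `exists_commutator_eq_smul` cover almost all of the space. -/
theorem exists_cover_disjoint_translates (μ : Measure X) (γ δ : Γ)
    (h1 : ∀ᵐ x ∂μ, γ • x ≠ x) (h2 : ∀ᵐ x ∂μ, δ • x ≠ x) (h3 : ∀ᵐ x ∂μ, γ • x ≠ δ • x) :
    ∃ A : ℕ → Set X, (∀ i, MeasurableSet (A i)) ∧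
      (∀ i, (∀ x ∈ A i, γ • x ∉ A i) ∧ (∀ x ∈ A i, δ • x ∉ A i) ∧
        ∀ x ∈ A i, γ⁻¹ • δ • x ∉ A i) ∧ ∀ᵐ x ∂μ, ∃ i, x ∈ A i := by
  let f := embeddingReal X
  have hf : Measurable f := measurable_embeddingReal X
  have hinj : Function.Injective f := (measurableEmbedding_embeddingReal X).injective
  -- `F n` partitions X at scale 1/n through a real embedding; any two distinct points are separated
  -- for all large n.
  let F : ℕ → X → ℤ := fun n x => ⌊(n : ℝ) * f x⌋
  have hF : ∀ n, Measurable (F n) := fun n => (hf.const_mul _).floor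
  have sep : ∀ x y, x ≠ y → ∀ᶠ n in atTop, F n x ≠ F n y := fun x y hxy => by
    have hpos : 0 < |f x - f y| := abs_pos.2 (sub_ne_zero.2 (hinj.ne hxy))
    obtain ⟨N, hN⟩ := exists_nat_gt (1 / |f x - f y|)
    filter_upwards [eventually_ge_atTop N] with n hn heq
    have := Int.abs_sub_lt_one_of_floor_eq_floor heq
    rw [← mul_sub, abs_mul, Nat.abs_cast] at this
    have h' : 1 < (N : ℝ) * |f x - f y| := (div_lt_iff₀ hpos).1 hN
    have : (N : ℝ) ≤ n := Nat.cast_le.2 hn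
    nlinarith
  -- On `B (n, i, j, k)` the labels of x, γx, δx are i, j, k. When these are distinct, the set and
  -- its two translates carry different labels and so are disjoint.
  let B : ℕ × ℤ × ℤ × ℤ → Set X := fun p =>
    if p.2.1 ≠ p.2.2.1 ∧ p.2.1 ≠ p.2.2.2 ∧ p.2.2.1 ≠ p.2.2.2 then
      {x | F p.1 x = p.2.1 ∧ F p.1 (γ • x) = p.2.2.1 ∧ F p.1 (δ • x) = p.2.2.2} else ∅
  obtain ⟨e, he⟩ := exists_surjective_nat (ℕ × ℤ × ℤ × ℤ)
  have hB : ∀ p, MeasurableSet (B p) ∧ (∀ x ∈ B p, γ • x ∉ B p) ∧ (∀ x ∈ B p, δ • x ∉ B p) ∧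
      ∀ x ∈ B p, γ⁻¹ • δ • x ∉ B p := by
    rintro ⟨n, i, j, k⟩
    by_cases hp : i ≠ j ∧ i ≠ k ∧ j ≠ k
    · have : B (n, i, j, k) = {x | F n x = i ∧ F n (γ • x) = j ∧ F n (δ • x) = k} := if_pos hp
      rw [this]
      refine ⟨?_, ?_, ?_, ?_⟩
      · exact ((hF n) (measurableSet_singleton i)).inter
          ((((hF n).comp (measurable_const_smul γ)) (measurableSet_singleton j)).inter
            (((hF n).comp (measurable_const_smul δ)) (measurableSet_singleton k)))
      · rintro x ⟨_, h, _⟩ ⟨h', _⟩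
        exact hp.1 (h'.symm.trans h)
      · rintro x ⟨_, _, h⟩ ⟨h', _⟩
        exact hp.2.1 (h'.symm.trans h)
      · rintro x ⟨_, _, h⟩ ⟨_, h', _⟩
        rw [smul_inv_smul] at h'
        exact hp.2.2 (h'.symm.trans h)
    · have : B (n, i, j, k) = ∅ := if_neg hp
      simp [this]
  refine ⟨fun i => B (e i), fun i => (hB _).1, fun i => (hB _).2, ?_⟩
  filter_upwards [h1, h2, h3] with x h1 h2 h3
  obtain ⟨n, hn1, hn2, hn3⟩ := ((sep _ _ h1).and ((sep _ _ h2).and (sep _ _ h3))).exists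
  obtain ⟨i, hi⟩ := he (n, F n x, F n (γ • x), F n (δ • x))
  refine ⟨i, ?_⟩
  rw [hi]
  have : B (n, F n x, F n (γ • x), F n (δ • x)) =
    {y | F n y = F n x ∧ F n (γ • y) = F n (γ • x) ∧ F n (δ • y) = F n (δ • x)} :=
    if_pos ⟨hn1.symm, hn2.symm, hn3⟩
  rw [this]
  exact ⟨rfl, rfl, rfl⟩

end Swap

/-! ### The compact space of orbit charges and the action on it -/

section OrbitCharge

/-- Presents the orbit relation as the case B = Γ of the sets {(x, y) : x ∈ By}, giving its
measurability and the total mass of the mean on Γ. -/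
theorem setOf_mem_orbit_eq {Γ : Type v} [Group Γ] {X : Type u} [MulAction Γ X] :
    {p : X × X | p.1 ∈ MulAction.orbit Γ p.2} = {p | ∃ g ∈ (univ : Set Γ), g • p.2 = p.1} := by
  ext p
  simp [MulAction.mem_orbit_iff]

variable {X : Type u} [MeasurableSpace X]

/-- A finitely additive probability measure on the measurable subsets of `X × X` (extended by zero)
with first marginal `μ`, concentrated on the orbit equivalence relation of `Γ`. -/
structure IsOrbitCharge (Γ : Type v) [Group Γ] [MulAction Γ X] (μ : Measure X)
    (m : Set (X × X) → ℝ) : Prop where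
  nonneg : ∀ E, 0 ≤ m E
  le_one : ∀ E, m E ≤ 1
  eq_zero : ∀ E, ¬ MeasurableSet E → m E = 0
  union : ∀ E F, MeasurableSet E → MeasurableSet F → Disjoint E F → m (E ∪ F) = m E + m F
  fst : ∀ A, MeasurableSet A → m (Prod.fst ⁻¹' A) = μ.real A
  orbit : m {p | p.1 ∈ MulAction.orbit Γ p.2} = 1

namespace IsOrbitCharge

variable {Γ : Type v} [Group Γ] [MulAction Γ X] {μ : Measure X} {m : Set (X × X) → ℝ}

theorem mono (hm : IsOrbitCharge Γ μ m) {E F : Set (X × X)} (hE : MeasurableSet E)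
    (hF : MeasurableSet F) (h : E ⊆ F) : m E ≤ m F := by
  rw [← union_sdiff_cancel h, hm.union _ _ hE (hF.diff hE) disjoint_sdiff_right]
  exact le_add_of_nonneg_right (hm.nonneg _)

/-- The two sets differ only over A, where the charge has total mass μ(A). This estimate replaces
countable additivity throughout. -/
theorem abs_sub_le (hm : IsOrbitCharge Γ μ m) {E F : Set (X × X)} (hE : MeasurableSet E)
    (hF : MeasurableSet F) {A : Set X} (hA : MeasurableSet A)
    (h : ∀ x ∉ A, ∀ y, (x, y) ∈ E ↔ (x, y) ∈ F) : |m E - m F| ≤ μ.real A := by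
  have hA' : MeasurableSet (Prod.fst ⁻¹' A : Set (X × X)) := hA.preimage measurable_fst
  have split : ∀ G : Set (X × X), MeasurableSet G →
      m G = m (G ∩ Prod.fst ⁻¹' A) + m (G \ Prod.fst ⁻¹' A) := fun G hG => by
    rw [← hm.union _ _ (hG.inter hA') (hG.diff hA')
      (disjoint_sdiff_right.mono_left inter_subset_right), inter_union_sdiff]
  have heq : E \ Prod.fst ⁻¹' A = F \ Prod.fst ⁻¹' A := by
    ext ⟨x, y⟩
    exact ⟨fun hx => ⟨(h x hx.2 y).1 hx.1, hx.2⟩, fun hx => ⟨(h x hx.2 y).2 hx.1, hx.2⟩⟩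
  rw [split E hE, split F hF, heq, add_sub_add_right_eq_sub, ← hm.fst A hA, abs_le]
  have h1 := hm.mono (hE.inter hA') hA' inter_subset_right
  have h2 := hm.mono (hF.inter hA') hA' inter_subset_right
  have h3 := hm.nonneg (E ∩ Prod.fst ⁻¹' A)
  have h4 := hm.nonneg (F ∩ Prod.fst ⁻¹' A)
  constructor <;> linarith

theorem congr_ae (hm : IsOrbitCharge Γ μ m) {E F : Set (X × X)} (hE : MeasurableSet E)
    (hF : MeasurableSet F) (h : ∀ᵐ x ∂μ, ∀ y, (x, y) ∈ E ↔ (x, y) ∈ F) : m E = m F := by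
  set N : Set X := {x | ¬ ∀ y, (x, y) ∈ E ↔ (x, y) ∈ F}
  have hN : μ N = 0 := h
  have := hm.abs_sub_le hE hF (measurableSet_toMeasurable μ N) fun x hx =>
    not_not.1 fun hx' => hx (subset_toMeasurable μ N hx')
  rw [measureReal_def, measure_toMeasurable, hN] at this
  exact sub_eq_zero.1 (abs_nonpos_iff.1 this)

end IsOrbitCharge

theorem MeasureAut.measurable_prodMap {μ : Measure X} (T : MeasureAut μ) :
    Measurable (Prod.map T id : X × X → X × X) :=
  T.measurable.prodMap measurable_id

/-- The converse direction ensures that the value zero on nonmeasurable sets survives the action. -/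
theorem MeasureAut.measurableSet_prodMap_preimage {μ : Measure X} (T : MeasureAut μ)
    {E : Set (X × X)} : MeasurableSet (Prod.map T id ⁻¹' E) ↔ MeasurableSet E := by
  refine ⟨fun h => ?_, fun h => h.preimage T.measurable_prodMap⟩
  have h' := h.preimage (T.rep.2.2.measurable.prodMap (measurable_id (α := X)))
  convert h' using 1
  ext ⟨x, y⟩
  simp

variable {Γ : Type v} [Group Γ] [MulAction Γ X] {μ : Measure X}

theorem IsOrbitCharge.congr_ae_preimage {m : Set (X × X) → ℝ} (hm : IsOrbitCharge Γ μ m)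
    {f g : X → X} (hf : Measurable f) (hg : Measurable g) (h : ∀ᵐ x ∂μ, f x = g x)
    {E : Set (X × X)} (hE : MeasurableSet E) :
    m (Prod.map f id ⁻¹' E) = m (Prod.map g id ⁻¹' E) := by
  refine hm.congr_ae (hE.preimage (hf.prodMap measurable_id))
    (hE.preimage (hg.prodMap measurable_id)) ?_
  filter_upwards [h] with x hx y
  simp [hx]

variable (Γ μ) in
/-- The compact convex space of all functions satisfying `IsOrbitCharge`. -/
def OrbitCharge : Type u := {m : Set (X × X) → ℝ // IsOrbitCharge Γ μ m}

namespace OrbitCharge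

instance : TopologicalSpace (OrbitCharge Γ μ) := inferInstanceAs (TopologicalSpace (Subtype _))

instance : T2Space (OrbitCharge Γ μ) := inferInstanceAs (T2Space (Subtype _))

theorem continuous_apply (E : Set (X × X)) : Continuous fun m : OrbitCharge Γ μ => m.1 E :=
  (_root_.continuous_apply E).comp continuous_subtype_val

/-- Each defining condition involves finitely many coordinates, hence is closed in a product of unit
intervals. Countable additivity would not be a closed condition. -/
instance : CompactSpace (OrbitCharge Γ μ) := by
  refine (isCompact_iff_compactSpace (s := {m | IsOrbitCharge Γ μ m})).1 ?_
  have hc : IsCompact (Set.pi univ fun _ : Set (X × X) => Icc (0 : ℝ) 1) :=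
    isCompact_univ_pi fun _ => isCompact_Icc
  refine hc.of_isClosed_subset ?_ fun m hm E _ => ⟨hm.nonneg E, hm.le_one E⟩
  have : {m | IsOrbitCharge Γ μ m} =
      {m | ∀ E, 0 ≤ m E} ∩ {m | ∀ E, m E ≤ 1} ∩ {m | ∀ E, ¬ MeasurableSet E → m E = 0} ∩
      {m | ∀ E F, MeasurableSet E → MeasurableSet F → Disjoint E F → m (E ∪ F) = m E + m F} ∩
      {m | ∀ A, MeasurableSet A → m (Prod.fst ⁻¹' A) = μ.real A} ∩
      {m | m {p | p.1 ∈ MulAction.orbit Γ p.2} = 1} := by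
    ext m
    exact ⟨fun h => ⟨⟨⟨⟨⟨h.1, h.2⟩, h.3⟩, h.4⟩, h.5⟩, h.6⟩,
      fun ⟨⟨⟨⟨⟨h1, h2⟩, h3⟩, h4⟩, h5⟩, h6⟩ => ⟨h1, h2, h3, h4, h5, h6⟩⟩
  rw [this]
  have c : ∀ E : Set (X × X), Continuous fun m : Set (X × X) → ℝ => m E :=
    fun E => _root_.continuous_apply E
  simp only [ofPred_forall]
  refine ((((IsClosed.inter ?_ ?_).inter ?_).inter ?_).inter ?_).inter ?_
  · exact isClosed_iInter fun E => isClosed_le continuous_const (c E)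
  · exact isClosed_iInter fun E => isClosed_le (c E) continuous_const
  · exact isClosed_iInter fun E => isClosed_iInter fun _ => isClosed_eq (c E) continuous_const
  · exact isClosed_iInter fun E => isClosed_iInter fun F => isClosed_iInter fun _ =>
      isClosed_iInter fun _ => isClosed_iInter fun _ => isClosed_eq (c _) ((c E).add (c F))
  · exact isClosed_iInter fun A => isClosed_iInter fun _ => isClosed_eq (c _) continuous_const
  · exact isClosed_eq (c _) continuous_const

end OrbitCharge

variable [StandardBorelSpace X] [MeasurableConstSMul Γ X]

theorem measurableSet_graph_smul [Countable Γ] (B : Set Γ) :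
    MeasurableSet {p : X × X | ∃ g ∈ B, g • p.2 = p.1} := by
  have : {p : X × X | ∃ g ∈ B, g • p.2 = p.1} = ⋃ g ∈ B, {p | g • p.2 = p.1} := by
    ext
    simp
  rw [this]
  exact MeasurableSet.biUnion B.to_countable fun g _ =>
    measurableSet_eq_fun (measurable_snd.const_smul g) measurable_fst

/-- The marginal persists because T preserves μ, the support because x and Tx almost surely share an
orbit. -/
theorem IsOrbitCharge.map [Countable Γ] {m : Set (X × X) → ℝ} (hm : IsOrbitCharge Γ μ m)
    {T : MeasureAut μ} (hT : T ∈ fullGroup Γ μ) :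
    IsOrbitCharge Γ μ fun E => m (Prod.map T id ⁻¹' E) where
  nonneg _ := hm.nonneg _
  le_one _ := hm.le_one _
  eq_zero E hE := hm.eq_zero _ fun h => hE (T.measurableSet_prodMap_preimage.1 h)
  union E F hE hF h := by
    rw [preimage_union]
    exact hm.union _ _ (hE.preimage T.measurable_prodMap) (hF.preimage T.measurable_prodMap)
      (h.preimage _)
  fst A hA := by
    have : Prod.map T id ⁻¹' (Prod.fst ⁻¹' A : Set (X × X)) = Prod.fst ⁻¹' (T ⁻¹' A) := rfl
    rw [this, hm.fst _ (hA.preimage T.measurable), measureReal_def,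
      T.measurePreserving.measure_preimage hA.nullMeasurableSet, measureReal_def]
  orbit := by
    rw [← hm.orbit]
    have hR : MeasurableSet {p : X × X | p.1 ∈ MulAction.orbit Γ p.2} := by
      rw [setOf_mem_orbit_eq]
      exact measurableSet_graph_smul _
    refine hm.congr_ae (hR.preimage T.measurable_prodMap) hR ?_
    have hT' : ∀ᵐ x ∂μ, T x ∈ MulAction.orbit Γ x := hT
    filter_upwards [hT'] with x hx y
    change T x ∈ MulAction.orbit Γ y ↔ x ∈ MulAction.orbit Γ y
    rw [← MulAction.orbit_eq_iff, ← MulAction.orbit_eq_iff, MulAction.orbit_eq_iff.2 hx]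

namespace OrbitCharge

-- The witness is the image of μ on the diagonal.
open Classical in
instance [Countable Γ] [IsProbabilityMeasure μ] : Nonempty (OrbitCharge Γ μ) := by
  have hd : Measurable fun x : X => (x, x) := measurable_id.prodMk measurable_id
  refine ⟨⟨fun E => if MeasurableSet E then μ.real ((fun x => (x, x)) ⁻¹' E) else 0, ?_⟩⟩
  refine ⟨fun E => ?_, fun E => ?_, fun E hE => if_neg hE, fun E F hE hF h => ?_, fun A hA => ?_,
    ?_⟩
  · split_ifs
    exacts [measureReal_nonneg, le_rfl]
  · split_ifs
    exacts [measureReal_le_one, zero_le_one]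
  · rw [if_pos hE, if_pos hF, if_pos (hE.union hF), preimage_union,
      measureReal_union (h.preimage _) (hF.preimage hd)]
  · rw [if_pos (hA.preimage measurable_fst)]
    rfl
  · rw [if_pos]
    · simp
    · rw [setOf_mem_orbit_eq]
      exact measurableSet_graph_smul _

variable [Countable Γ] {S : Finset Γ}

noncomputable instance : MulAction (l1FullGroup μ S) (OrbitCharge Γ μ) where
  smul T m := ⟨fun E => m.1 (Prod.map T.1 id ⁻¹' E), m.2.map T.2.1⟩
  one_smul m := Subtype.ext <| funext fun E => by
    change m.1 (Prod.map (1 : MeasureAut μ) id ⁻¹' E) = m.1 E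
    by_cases hE : MeasurableSet E
    · exact m.2.congr_ae_preimage (MeasureAut.measurable _) measurable_id MeasureAut.one_ae hE
    · rw [m.2.eq_zero _ hE,
        m.2.eq_zero _ fun h => hE ((MeasureAut.measurableSet_prodMap_preimage _).1 h)]
  mul_smul T U m := Subtype.ext <| funext fun E => by
    change m.1 (Prod.map (T.1 * U.1) id ⁻¹' E) =
      m.1 (Prod.map U.1 id ⁻¹' (Prod.map T.1 id ⁻¹' E))
    by_cases hE : MeasurableSet E
    · exact m.2.congr_ae_preimage (MeasureAut.measurable _)
        (T.1.measurable.comp U.1.measurable) (MeasureAut.mul_ae _ _) hE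
    · rw [m.2.eq_zero _ fun h => hE ((MeasureAut.measurableSet_prodMap_preimage _).1 h),
        m.2.eq_zero _ fun h => hE ((MeasureAut.measurableSet_prodMap_preimage _).1
          ((MeasureAut.measurableSet_prodMap_preimage _).1 h))]

/-- Joint continuity holds because the error from replacing the transformation is at most the L¹
distance, uniformly in the charge. -/
instance [IsFiniteMeasure μ] : ContinuousSMul (l1FullGroup μ S) (OrbitCharge Γ μ) where
  continuous_smul := by
    refine Continuous.subtype_mk (continuous_pi fun E => ?_) _
    change Continuous fun p : l1FullGroup μ S × OrbitCharge Γ μ =>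
      p.2.1 (Prod.map p.1.1 id ⁻¹' E)
    by_cases hE : MeasurableSet E
    swap
    · exact continuous_const.congr fun p => (p.2.2.eq_zero _
        fun h => hE ((MeasureAut.measurableSet_prodMap_preimage _).1 h)).symm
    refine continuous_iff_continuousAt.2 fun ⟨T, m⟩ => tendsto_iff_dist_tendsto_zero.2 ?_
    have h1 : Tendsto (fun p : l1FullGroup μ S × OrbitCharge Γ μ => (edist p.1 T).toReal)
        (𝓝 (T, m)) (𝓝 0) := by
      have : Tendsto (fun p : l1FullGroup μ S × OrbitCharge Γ μ => edist p.1 T)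
        (𝓝 (T, m)) (𝓝 0) := tendsto_iff_edist_tendsto_0.1 continuous_fst.continuousAt
      exact (ENNReal.tendsto_toReal ENNReal.zero_ne_top).comp this
    have h2 : Tendsto (fun p : l1FullGroup μ S × OrbitCharge Γ μ =>
        dist (p.2.1 (Prod.map T.1 id ⁻¹' E)) (m.1 (Prod.map T.1 id ⁻¹' E)))
        (𝓝 (T, m)) (𝓝 0) := tendsto_iff_dist_tendsto_zero.1
      ((continuous_apply _).comp continuous_snd).continuousAt
    refine squeeze_zero (fun _ => dist_nonneg) (fun p => ?_) (by simpa using h1.add h2)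
    refine (dist_triangle _ (p.2.1 (Prod.map T.1 id ⁻¹' E)) _).trans (add_le_add ?_ le_rfl)
    rw [Real.dist_eq]
    refine (p.2.2.abs_sub_le (hE.preimage p.1.1.measurable_prodMap)
      (hE.preimage T.1.measurable_prodMap)
      (measurableSet_eq_fun p.1.1.measurable T.1.measurable).compl fun x hx y => ?_).trans ?_
    · have : p.1.1 x = T.1 x := not_not.1 hx
      simp [this]
    · exact ENNReal.toReal_mono (l1FullGroup.edist_ne_top _ _)
        (l1FullGroup.measure_ne_le_edist _ _)

end OrbitCharge

end OrbitCharge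

/-! ### From commutator invariance to an invariant mean on Γ -/

section Invariance

variable {X : Type u} [MeasurableSpace X] {Γ : Type v} [Group Γ]
  [MulAction Γ X] {μ : Measure X}

/-- The barycenter of a probability measure on `OrbitCharge Γ μ`. -/
theorem IsOrbitCharge.integral [MeasurableSpace (OrbitCharge Γ μ)] [BorelSpace (OrbitCharge Γ μ)]
    (ν : Measure (OrbitCharge Γ μ)) [IsProbabilityMeasure ν] :
    IsOrbitCharge Γ μ fun E => ∫ m, m.1 E ∂ν := by
  have hint : ∀ E, Integrable (fun m : OrbitCharge Γ μ => m.1 E) ν := fun E =>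
    Integrable.of_bound (OrbitCharge.continuous_apply E).aestronglyMeasurable 1 <|
      ae_of_all _ fun m => by
        rw [Real.norm_of_nonneg (m.2.nonneg E)]
        exact m.2.le_one E
  refine ⟨fun E => integral_nonneg fun m => m.2.nonneg E, fun E => ?_, fun E hE => ?_,
    fun E F hE hF h => ?_, fun A hA => ?_, ?_⟩
  · simpa using integral_mono (hint E) (integrable_const 1) fun m => m.2.le_one E
  · simp [fun m : OrbitCharge Γ μ => m.2.eq_zero E hE]
  · simp only [fun m : OrbitCharge Γ μ => m.2.union E F hE hF h]
    exact integral_add (hint E) (hint F)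
  · simp [fun m : OrbitCharge Γ μ => m.2.fst A hA]
  · simp [fun m : OrbitCharge Γ μ => m.2.orbit]

variable [MeasurableConstSMul Γ X]

/-- Invariance under transformations that agree with `γ` on each of a sequence of sets covering
almost all of the space implies invariance under `γ`. -/
theorem IsOrbitCharge.preimage_smul_eq [IsFiniteMeasure μ] [SMulInvariantMeasure Γ X μ]
    {m : Set (X × X) → ℝ} (hm : IsOrbitCharge Γ μ m) (γ : Γ) (A : ℕ → Set X)
    (hA : ∀ i, MeasurableSet (A i)) (hcov : ∀ᵐ x ∂μ, ∃ i, x ∈ A i) (T : ℕ → MeasureAut μ)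
    (hT : ∀ i, ∀ᵐ x ∂μ, x ∈ A i → T i x = γ • x)
    (hinv : ∀ i E, MeasurableSet E → m (Prod.map (T i) id ⁻¹' E) = m E)
    {E : Set (X × X)} (hE : MeasurableSet E) : m (Prod.map (γ • ·) id ⁻¹' E) = m E := by
  have hγ : Measurable (Prod.map (γ • ·) id : X × X → X × X) :=
    (measurable_const_smul γ).prodMap measurable_id
  have hfst : Measurable fun p : X × X => γ⁻¹ • p.1 := measurable_fst.const_smul γ⁻¹
  -- For sets lying over γAᵢ, the preimages under γ and Tᵢ agree up to a null set of first
  -- coordinates.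
  have piece : ∀ i F, MeasurableSet F → (∀ p ∈ F, γ⁻¹ • p.1 ∈ A i) →
      m (Prod.map (γ • ·) id ⁻¹' F) = m F := fun i F hF hFA => by
    rw [← hinv i F hF]
    refine hm.congr_ae (hF.preimage hγ) (hF.preimage (T i).measurable_prodMap) ?_
    have h' : ∀ᵐ x ∂μ, γ⁻¹ • T i x ∈ A i → T i (γ⁻¹ • T i x) = γ • γ⁻¹ • T i x :=
      (T i).ae_comp ((measurePreserving_smul γ⁻¹ μ).quasiMeasurePreserving.ae (hT i))
    filter_upwards [hT i, h'] with x h1 h2 y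
    change (γ • x, y) ∈ F ↔ (T i x, y) ∈ F
    constructor
    · intro h
      have := hFA _ h
      simp only [inv_smul_smul] at this
      rwa [h1 this]
    · intro h
      have hx := hFA _ h
      have h3 := h2 hx
      rw [smul_inv_smul] at h3
      -- Nothing outside Aᵢ enters γAᵢ under Tᵢ: the point γ⁻¹Tᵢx of Aᵢ has the same Tᵢ-image as x.
      have h4 : γ⁻¹ • T i x = x := (T i).rep.1.injective h3
      rw [← h1 (h4 ▸ hx)]
      exact h
  let B : ℕ → Set X := fun n => ⋃ i < n, A i
  have hB : ∀ n, MeasurableSet (B n) := fun n =>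
    MeasurableSet.biUnion (to_countable _) fun i _ => hA i
  have union : ∀ n F, MeasurableSet F → (∀ p ∈ F, γ⁻¹ • p.1 ∈ B n) →
      m (Prod.map (γ • ·) id ⁻¹' F) = m F := by
    intro n
    induction n with
    | zero =>
      intro F _ h
      have : F = ∅ := eq_empty_of_forall_notMem fun p hp => by simpa [B] using h p hp
      simp [this]
    | succ n ih =>
      intro F hF h
      have hD : MeasurableSet {p : X × X | γ⁻¹ • p.1 ∈ A n} := (hA n).preimage hfst
      have hd : Disjoint (F ∩ {p | γ⁻¹ • p.1 ∈ A n}) (F \ {p | γ⁻¹ • p.1 ∈ A n}) :=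
        disjoint_sdiff_right.mono_left inter_subset_right
      rw [← inter_union_sdiff F {p | γ⁻¹ • p.1 ∈ A n}, preimage_union,
        hm.union _ _ ((hF.inter hD).preimage hγ) ((hF.diff hD).preimage hγ) (hd.preimage _),
        hm.union _ _ (hF.inter hD) (hF.diff hD) hd,
        piece n _ (hF.inter hD) fun p hp => hp.2, ih _ (hF.diff hD) fun p hp => ?_]
      have := h p hp.1
      simp only [B, mem_iUnion, exists_prop] at this ⊢
      obtain ⟨i, hi, hpi⟩ := this
      rcases (Nat.lt_succ_iff_lt_or_eq.1 hi) with hi | rfl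
      · exact ⟨i, hi, hpi⟩
      · exact absurd hpi hp.2
  -- Truncating E to the part over γBₙ costs μ(X \ Bₙ) twice, once for E and once for its preimage.
  have bound : ∀ n, |m (Prod.map (γ • ·) id ⁻¹' E) - m E| ≤
      μ.real (B n)ᶜ + μ.real (B n)ᶜ := fun n => by
    have hEn : MeasurableSet (E ∩ {p | γ⁻¹ • p.1 ∈ B n}) := hE.inter ((hB n).preimage hfst)
    have h1 := hm.abs_sub_le (hE.preimage hγ) (hEn.preimage hγ) (hB n).compl fun x hx y => by
      have : x ∈ B n := not_not.1 hx
      simp [this]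
    have h2 := hm.abs_sub_le hEn hE ((hB n).compl.preimage (measurable_const_smul γ⁻¹))
      fun x hx y => by
        have : γ⁻¹ • x ∈ B n := not_not.1 hx
        simp [this]
    rw [measureReal_def, measure_preimage_smul_of_nullMeasurableSet (hB n).compl.nullMeasurableSet,
      ← measureReal_def] at h2
    rw [union n _ hEn fun p hp => hp.2] at h1
    exact (_root_.abs_sub_le _ _ _).trans (add_le_add h1 h2)
  have hlim : Tendsto (fun n => μ.real (B n)ᶜ) atTop (𝓝 0) := by
    have hmono : Antitone fun n => (B n)ᶜ := fun i j hij =>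
      compl_subset_compl.2 (biUnion_subset_biUnion_left fun k hk => lt_of_lt_of_le hk hij)
    have h := tendsto_measure_iInter_atTop (μ := μ)
      (fun n => (hB n).compl.nullMeasurableSet) hmono ⟨0, measure_ne_top _ _⟩
    have h0 : μ (⋂ n, (B n)ᶜ) = 0 := by
      refine measure_mono_null (fun x hx => ?_) hcov
      rintro ⟨i, hi⟩
      exact mem_iInter.1 hx (i + 1) (mem_biUnion (Nat.lt_succ_self i) hi)
    rw [h0] at h
    exact (ENNReal.tendsto_toReal ENNReal.zero_ne_top).comp h
  have h0 := ge_of_tendsto' (hlim.add hlim) bound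
  rw [add_zero] at h0
  exact sub_eq_zero.1 (abs_nonpos_iff.1 h0)

variable [StandardBorelSpace X]

/-- A `Γ`-invariant finitely additive measure on the orbit equivalence relation of an essentially
free action yields an invariant finitely additive measure on `Γ`. -/
theorem IsOrbitCharge.isAmenableGroup [Countable Γ] [TopologicalSpace Γ]
    [IsProbabilityMeasure μ]
    (hfree : ∀ γ : Γ, γ ≠ 1 → ∀ᵐ x ∂μ, γ • x ≠ x) {m : Set (X × X) → ℝ}
    (hm : IsOrbitCharge Γ μ m)
    (hinv : ∀ (γ : Γ) E, MeasurableSet E → m (Prod.map (γ • ·) id ⁻¹' E) = m E) :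
    IsAmenableGroup Γ := by
  let R : Set Γ → Set (X × X) := fun B => {p | ∃ g ∈ B, g • p.2 = p.1}
  have hR : ∀ B, MeasurableSet (R B) := measurableSet_graph_smul
  refine .of_invariant_additive (fun B => ⟨m (R B), hm.nonneg _⟩) ?_ (fun s t hst => ?_)
    fun g s => ?_
  · refine NNReal.eq ?_
    change m (R univ) = 1
    rw [← hm.orbit, setOf_mem_orbit_eq]
  · refine NNReal.eq ?_
    change m (R (s ∪ t)) = m (R s) + m (R t)
    have h1 : R (s ∪ t) = R s ∪ (R t \ R s) := by
      rw [union_sdiff_self]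
      ext p
      simp only [R, mem_union, mem_ofPred_eq, or_and_right, exists_or]
    rw [h1, hm.union _ _ (hR s) ((hR t).diff (hR s)) disjoint_sdiff_right]
    congr 1
    refine hm.congr_ae ((hR t).diff (hR s)) (hR t) ?_
    have hf : ∀ᵐ x ∂μ, ∀ γ : Γ, γ ≠ 1 → γ • x ≠ x :=
      ae_all_iff.2 fun γ => by
        by_cases h : γ = 1
        · simp [h]
        · filter_upwards [hfree γ h] with x hx _ using hx
    filter_upwards [hf] with x hx y
    refine ⟨fun h => h.1, fun h => ⟨h, ?_⟩⟩
    rintro ⟨g, hg, hgy⟩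
    obtain ⟨k, hk, hky⟩ := h
    simp only at hgy hky
    -- An overlap means gy = ky = x, so kg⁻¹ fixes x. It matters that the fixed point is the first
    -- coordinate, whose marginal is μ.
    have hgk : k * g⁻¹ ≠ 1 := fun h => by
      rw [mul_inv_eq_one] at h
      exact disjoint_left.1 hst hg (h ▸ hk)
    refine hx _ hgk ?_
    rw [mul_smul, ← hgy, inv_smul_smul, hky, hgy]
  · refine NNReal.eq ?_
    change m (R ((g * ·) ⁻¹' s)) = m (R s)
    rw [← hinv g _ (hR s)]
    congr 1
    ext ⟨x, y⟩
    simp only [R, mem_ofPred_eq, mem_preimage, Prod.map, id]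
    constructor
    · rintro ⟨k, hk, rfl⟩
      exact ⟨g * k, hk, mul_smul _ _ _⟩
    · rintro ⟨k, hk, h⟩
      refine ⟨g⁻¹ * k, by simpa using hk, ?_⟩
      rw [mul_smul, h, inv_smul_smul]

/-- Asking for invariance only under the abstract derived subgroup lets one argument serve both
groups of the theorem. -/
theorem isAmenableGroup_of_commutator_invariant [TopologicalSpace Γ]
    [IsProbabilityMeasure μ] [SMulInvariantMeasure Γ X μ]
    (hfree : ∀ γ : Γ, γ ≠ 1 → ∀ᵐ x ∂μ, γ • x ≠ x)
    {S : Finset Γ} (hS : Subgroup.closure (S : Set Γ) = ⊤) [Countable Γ]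
    [MeasurableSpace (OrbitCharge Γ μ)] [BorelSpace (OrbitCharge Γ μ)]
    (ν : Measure (OrbitCharge Γ μ)) [IsProbabilityMeasure ν]
    (hν : ∀ T ∈ commutator (l1FullGroup μ S), ∀ s : Set (OrbitCharge Γ μ), MeasurableSet s →
      ν ((T • ·) ⁻¹' s) = ν s) : IsAmenableGroup Γ := by
  by_cases hfin : Finite Γ
  · exact .of_finite Γ
  have hinf : Infinite Γ := not_finite_iff_infinite.1 hfin
  have hm := IsOrbitCharge.integral ν
  have hminv : ∀ T ∈ commutator (l1FullGroup μ S), ∀ E,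
      ∫ m, m.1 (Prod.map T.1 id ⁻¹' E) ∂ν = ∫ m, m.1 E ∂ν := fun T hT E => by
    have hmeas : Measurable (fun m : OrbitCharge Γ μ => T • m) :=
      (continuous_const_smul T).measurable
    have hmap : ν.map (T • ·) = ν := Measure.ext fun s hs => by
      rw [Measure.map_apply hmeas hs, hν T hT s hs]
    conv_rhs => rw [← hmap]
    rw [integral_map hmeas.aemeasurable
      (OrbitCharge.continuous_apply E).aestronglyMeasurable]
    rfl
  refine hm.isAmenableGroup hfree fun γ E hE => ?_
  by_cases hγ : γ = 1
  · have : (Prod.map (γ • ·) id : X × X → X × X) = id := by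
      ext p <;> simp [hγ]
    rw [this, preimage_id]
  -- With δ different from 1 and γ, freeness makes x, γx, δx almost surely distinct.
  obtain ⟨δ, hδ⟩ := Set.Infinite.nonempty (s := ({1, γ} : Set Γ)ᶜ) (toFinite _).infinite_compl
  have hδ1 : δ ≠ 1 := fun h => hδ (by simp [h])
  have hδγ : δ⁻¹ * γ ≠ 1 := fun h => hδ (by simp [inv_mul_eq_one.1 h])
  have h3 : ∀ᵐ x ∂μ, γ • x ≠ δ • x := by
    filter_upwards [hfree _ hδγ] with x hx h
    exact hx (by rw [mul_smul, h, inv_smul_smul])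
  obtain ⟨A, hA, hdisj, hcov⟩ :=
    exists_cover_disjoint_translates μ γ δ (hfree γ hγ) (hfree δ hδ1) h3
  choose T hT hTA using fun i =>
    exists_commutator_eq_smul μ hS γ δ (hA i) (hdisj i).1 (hdisj i).2.1 (hdisj i).2.2
  exact hm.preimage_smul_eq γ A hA hcov (fun i => (T i).1) hTA
    (fun i F _ => hminv _ (hT i) F) hE

end Invariance

theorem mainTheorem7 {Γ : Type v} [Group Γ] [TopologicalSpace Γ] [DiscreteTopology Γ]
    (hΓ : ¬ IsAmenableGroup Γ)
    {X : Type u} [MeasurableSpace X] [StandardBorelSpace X]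
    (μ : Measure X) [IsProbabilityMeasure μ]
    [MulAction Γ X] [MeasurableConstSMul Γ X] [SMulInvariantMeasure Γ X μ]
    (hfree : ∀ γ : Γ, γ ≠ 1 → ∀ᵐ x ∂μ, γ • x ≠ x)
    (S : Finset Γ) (hS : Subgroup.closure (S : Set Γ) = ⊤) :
    ¬ IsAmenableGroup (l1FullGroup μ S) ∧
      ¬ IsAmenableGroup (commutator (l1FullGroup μ S)).topologicalClosure := by
  have hcount : Countable Γ := countable_of_closure_eq_top hS
  let _ : MeasurableSpace (OrbitCharge Γ μ) := borel _
  have : BorelSpace (OrbitCharge Γ μ) := ⟨rfl⟩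
  -- Both groups contain the derived subgroup, and the closure acts on the same space by
  -- restriction.
  constructor
  · intro h
    obtain ⟨ν, hν, hinv⟩ := h (OrbitCharge Γ μ)
    exact hΓ (isAmenableGroup_of_commutator_invariant hfree hS ν fun T _ s hs =>
      hinv.measure_preimage_smul T hs)
  · intro h
    obtain ⟨ν, hν, hinv⟩ := h (OrbitCharge Γ μ)
    exact hΓ (isAmenableGroup_of_commutator_invariant hfree hS ν fun T hT s hs =>
      hinv.measure_preimage_smul ⟨T, Subgroup.le_topologicalClosure _ hT⟩ hs)
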